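/- **The calculus.** Ordinary variables $x,y,\dots$ and continuation variables $k,l,\dots$ are distinct. Terms $M$ and jumps $J$ of the CCV $\lambda\mu$-calculus are, up to $\alpha$-conversion, $$M ::= x \mid \lambda x.M \mid MM \mid (M\ \mathsf{where}\ x:=M) \mid \mu k.J,\qquad J ::= [k]M \mid (J\ \mathsf{where}\ x:=M).$$ Here $\lambda x$ and $\mu k$ bind as usual, and $(L\ \mathsf{where}\ x:=M)$, with $L$ a term or a jump, binds $x$ in $L$ only. A value $V$ is a variable or a $\lambda$-abstraction; every other term is a non-value. The bracketing axioms are (A1) $(L\ \mathsf{where}\ x:=(M\ \mathsf{where}\ y:=N)) = ((L\ \mathsf{where}\ x:=M)\ \mathsf{where}\ y:=N)$ if $y$ is not free in $L$; (A2) $((\mu k.J)\ \mathsf{where}\ x:=M) = \mu k.(J\ \mathsf{where}\ x:=M)$ if $k$ is not free in $M$; (A3) $[k](L\ \mathsf{where}\ x:=M) = (([k]L)\ \mathsf{where}\ x:=M)$. The reduction rules are ($V$ a value, $N$ a non-value, $z$ fresh): $NM\to (zM\ \mathsf{where}\ z:=N)$; $VN\to (Vz\ \mathsf{where}\ z:=N)$;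 $(\lambda x.M)V\to (M\ \mathsf{where}\ x:=V)$; $(M\ \mathsf{where}\ x:=V)\to M\{V/x\}$; $(M\ \mathsf{where}\ x:=\mu k.J)\to \mu k.\,J\{[k]\square\mapsto[k](M\ \mathsf{where}\ x:=\square)\}$; $[l]\mu k.J\to J\{l/k\}$; $\lambda x.Vx\to V$ if $x$ is not free in $V$; $(x\ \mathsf{where}\ x:=M)\to M$; $\mu k.[k]M\to M$ if $k$ is not free in $M$. Here $J\{[k]\square\mapsto[k](M\ \mathsf{where}\ x:=\square)\}$ replaces recursively, and without capture, every $[k]Q$ in $J$ with $k$ free by $[k](M\ \mathsf{where}\ x:=Q)$. The CCV equality $=_{ccv}$ is the smallest congruence on terms and jumps that contains (A1)–(A3) and the reduction rules. **Call-by-value evaluation.** Evaluation contexts are $E ::= \square \mid E[V\square] \mid E[\square M] \mid E[M\ \mathsf{where}\ x:=\square]$. For evaluation, terms are not identified along (A1) and (A2), while along (A3) every jump is read in its unique form $[l]L$. The relation $\to_{E_0}$ is given by ($z$ fresh) $E[(\mu k.J)M]\to_{E_0} E[zM\ \mathsf{where}\ z:=\mu k.J]$; $E[V(\mu k.J)]\to_{E_0}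 E[Vz\ \mathsf{where}\ z:=\mu k.J]$; $E[(\lambda x.M)V]\to_{E_0} E[M\ \mathsf{where}\ x:=V]$; $E[M\ \mathsf{where}\ x:=V]\to_{E_0} E[M\{V/x\}]$; $E[M\ \mathsf{where}\ x:=\mu k.J]\to_{E_0} E[\mu k.\,J\{[k]\square\mapsto[k](M\ \mathsf{where}\ x:=\square)\}]$. The relation $\to_E$ is given by: $\mu k.[l]\mu m.J\to_E \mu k.\,J\{l/m\}$; and, if $L\to_{E_0}M$, then $L\to_E M$ and $\mu k.[l]L\to_E\mu k.[l]M$. A term is $E$-normal if it admits no $\to_E$ step. The call-by-value evaluation of $M$ terminates returning $N$ if $M\to_E^* N$ and $N$ is $E$-normal. **Corollary.** Let $M$ and $M'$ be terms. If the call-by-value evaluation of $M$ terminates returning $N$, and if $M=_{ccv}M'$, then the call-by-value evaluation of $M'$ terminates returning some $N'$. Moreover, the $E$-normal forms satisfy $N=_{ccv}N'$ (for every $N'$ that the evaluation of $M'$ returns). -/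

import Mathlib

namespace CCV

/-- The two syntactic categories of the calculus. -/
inductive Kind : Type
  | term
  | jump

/-- Raw syntax trees of the CCV lambda-mu calculus up to alpha-conversion (de Bruijn indices).
Ordinary variables and continuation variables are indexed separately by natural numbers:
`lam` and the body of `lets` bind the ordinary variable `0`, `mu` binds the continuation
variable `0`, and indices that exceed the number of enclosing binders are free variables.

* `var x` is `x`;
* `lam M` is `λ x. M`;
* `app M N` is `M N`;
* `mu J` is `μ k. J`;
* `jmp k M` is the jump `[k] M`;
* `lets L M` is `L where x := M`, in which `x` is bound in `L` only; `L` is a term or a jump,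
  and so is the result. -/
inductive Expr : Kind → Type
  | var (x : ℕ) : Expr .term
  | lam (M : Expr .term) : Expr .term
  | app (M N : Expr .term) : Expr .term
  | mu (J : Expr .jump) : Expr .term
  | jmp (k : ℕ) (M : Expr .term) : Expr .jump
  | lets {s : Kind} (L : Expr s) (M : Expr .term) : Expr s

abbrev Term : Type := Expr .term

abbrev Jump : Type := Expr .jump

/-- Extension of a renaming under one binder. -/
def up (ρ : ℕ → ℕ) : ℕ → ℕ
  | 0 => 0
  | n + 1 => ρ n + 1

/-- The renaming that replaces the variable `0` by `l` and lowers the other ones. -/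
def inst (l : ℕ) : ℕ → ℕ
  | 0 => l
  | n + 1 => n

namespace Expr

/-- Simultaneous capture-avoiding renaming of the free ordinary variables (by `ρ`) and of the
free continuation variables (by `κ`). -/
def rename (ρ κ : ℕ → ℕ) : {s : Kind} → Expr s → Expr s
  | _, var x => var (ρ x)
  | _, lam M => lam (rename (up ρ) κ M)
  | _, app M N => app (rename ρ κ M) (rename ρ κ N)
  | _, mu J => mu (rename ρ (up κ) J)
  | _, jmp k M => jmp (κ k) (rename ρ κ M)
  | _, lets L M => lets (rename (up ρ) κ L) (rename ρ κ M)

/-- Weakening by a fresh ordinary variable `0`. -/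
def wk {s : Kind} (M : Expr s) : Expr s := M.rename Nat.succ id

/-- Weakening by a fresh ordinary variable `1`, the variable `0` being kept. -/
def wkUnder {s : Kind} (M : Expr s) : Expr s := M.rename (up Nat.succ) id

/-- Weakening by a fresh continuation variable `0`. -/
def wkCont {s : Kind} (M : Expr s) : Expr s := M.rename id Nat.succ

/-- Extension of a substitution under one binder of an ordinary variable. -/
def upSubst (σ : ℕ → Term) : ℕ → Term
  | 0 => var 0
  | n + 1 => (σ n).wk

/-- Simultaneous capture-avoiding substitution for the ordinary variables. -/
def subst (σ : ℕ → Term) : {s : Kind} → Expr s → Expr s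
  | _, var x => σ x
  | _, lam M => lam (subst (upSubst σ) M)
  | _, app M N => app (subst σ M) (subst σ N)
  | _, mu J => mu (subst (fun n => (σ n).wkCont) J)
  | _, jmp k M => jmp k (subst σ M)
  | _, lets L M => lets (subst (upSubst σ) L) (subst σ M)

/-- The substitution `0 ↦ V`, lowering the other variables. -/
def single (V : Term) : ℕ → Term
  | 0 => V
  | n + 1 => var n

/-- `M{V/x}`, where `x` is the ordinary variable `0` of `M`. -/
def subst1 {s : Kind} (M : Expr s) (V : Term) : Expr s := M.subst (single V)

/-- `J{l/k}`, where `k` is the continuation variable `0` of `J`. -/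
def substCont {s : Kind} (J : Expr s) (l : ℕ) : Expr s := J.rename id (inst l)

/-- The capture-avoiding context substitution `P{[k]□ ↦ [k](M where x := □)}`, applied
recursively to all the free occurrences of `k` in `P`; here `x` is the ordinary variable `0`
of `M`. -/
def ctxSubst : (k : ℕ) → (M : Term) → {s : Kind} → (P : Expr s) → Expr s
  | _, _, _, var x => var x
  | k, M, _, lam P => lam (ctxSubst k M.wkUnder P)
  | k, M, _, app P Q => app (ctxSubst k M P) (ctxSubst k M Q)
  | k, M, _, mu J => mu (ctxSubst (k + 1) M.wkCont J)
  | k, M, _, jmp l Q =>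
      if l = k then jmp k (lets M (ctxSubst k M Q)) else jmp l (ctxSubst k M Q)
  | k, M, _, lets L Q => lets (ctxSubst k M.wkUnder L) (ctxSubst k M Q)

/-- Values are the variables and the lambda-abstractions. -/
def IsValue : Term → Prop
  | var _ => True
  | lam _ => True
  | _ => False

end Expr

open CCV.Expr

/-- The equality axioms that identify terms or jumps which differ in bracketing. The side
conditions `y ∉ L` and `k ∉ M` are expressed by weakening. -/
inductive BracketAx : {s : Kind} → Expr s → Expr s → Prop
  /-- `L where x := (M where y := N)` is `(L where x := M) where y := N` if `y ∉ L` -/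
  | assoc (L M N : Term) : BracketAx (lets L (lets M N)) (lets (lets L.wkUnder M) N)
  /-- `(μ k. J) where x := M` is `μ k. (J where x := M)` if `k ∉ M` -/
  | mu_lets (J : Jump) (M : Term) : BracketAx (lets (mu J) M) (mu (lets J M.wkCont))
  /-- `[k](L where x := M)` is `([k]L) where x := M` -/
  | jmp_lets (k : ℕ) (L M : Term) : BracketAx (jmp k (lets L M)) (lets (jmp k L) M)

/-- The reduction rules (at the root). -/
inductive Red : {s : Kind} → Expr s → Expr s → Prop
  /-- `N M → (z M where z := N)`, with `N` a non-value -/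
  | ad₁ (N M : Term) (hN : ¬ N.IsValue) : Red (app N M) (lets (app (var 0) M.wk) N)
  /-- `V N → (V z where z := N)`, with `V` a value and `N` a non-value -/
  | ad₂ (V N : Term) (hV : V.IsValue) (hN : ¬ N.IsValue) :
      Red (app V N) (lets (app V.wk (var 0)) N)
  /-- `(λ x. M) V → (M where x := V)` -/
  | beta_lam (M V : Term) (hV : V.IsValue) : Red (app (lam M) V) (lets M V)
  /-- `(M where x := V) → M{V/x}` -/
  | beta_let (M V : Term) (hV : V.IsValue) : Red (lets M V) (M.subst1 V)
  /-- `(M where x := μ k. J) → μ k. J{[k]□ ↦ [k](M where x := □)}` -/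
  | beta_mu (M : Term) (J : Jump) : Red (lets M (mu J)) (mu (ctxSubst 0 M.wkCont J))
  /-- `[l] μ k. J → J{l/k}` -/
  | beta_jmp (l : ℕ) (J : Jump) : Red (jmp l (mu J)) (J.substCont l)
  /-- `λ x. V x → V` if `x ∉ V` -/
  | eta_lam (V : Term) (hV : V.IsValue) : Red (lam (app V.wk (var 0))) V
  /-- `(x where x := M) → M` -/
  | eta_let (M : Term) : Red (lets (var 0) M) M
  /-- `μ k. [k] M → M` if `k ∉ M` -/
  | eta_mu (M : Term) : Red (mu (jmp 0 M.wkCont)) M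

/-- The CCV equality: the smallest congruence that contains the reduction rules, on terms and
jumps taken modulo the bracketing axioms. -/
inductive CcvEq : {s : Kind} → Expr s → Expr s → Prop
  | bracket {s : Kind} {P Q : Expr s} (h : BracketAx P Q) : CcvEq P Q
  | red {s : Kind} {P Q : Expr s} (h : Red P Q) : CcvEq P Q
  | refl {s : Kind} (P : Expr s) : CcvEq P P
  | symm {s : Kind} {P Q : Expr s} (h : CcvEq P Q) : CcvEq Q P
  | trans {s : Kind} {P Q R : Expr s} (h₁ : CcvEq P Q) (h₂ : CcvEq Q R) : CcvEq P R
  | lam {M M' : Term} (h : CcvEq M M') : CcvEq (lam M) (lam M')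
  | app {M M' N N' : Term} (h₁ : CcvEq M M') (h₂ : CcvEq N N') : CcvEq (app M N) (app M' N')
  | mu {J J' : Jump} (h : CcvEq J J') : CcvEq (mu J) (mu J')
  | jmp (k : ℕ) {M M' : Term} (h : CcvEq M M') : CcvEq (jmp k M) (jmp k M')
  | lets {s : Kind} {L L' : Expr s} {M M' : Term} (h₁ : CcvEq L L') (h₂ : CcvEq M M') :
      CcvEq (lets L M) (lets L' M')

/-- Evaluation contexts `E ::= □ | E[V □] | E[□ M] | E[M where x := □]`. The hole is never in
the scope of a binder of the context. -/
inductive ECtx : Type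
  | hole
  | appR (E : ECtx) (V : Term) (hV : V.IsValue)
  | appL (E : ECtx) (M : Term)
  | letArg (E : ECtx) (M : Term)

/-- Filling the hole. -/
def ECtx.plug : ECtx → Term → Term
  | hole, P => P
  | appR E V _, P => E.plug (app V P)
  | appL E M, P => E.plug (app P M)
  | letArg E M, P => E.plug (lets M P)

/-- The rewriting relation `E₀`. -/
inductive E₀Step : Term → Term → Prop
  /-- `E[(μ k. J) M] → E[z M where z := μ k. J]` -/
  | mu_app (E : ECtx) (J : Jump) (M : Term) :
      E₀Step (E.plug (app (mu J) M)) (E.plug (lets (app (var 0) M.wk) (mu J)))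
  /-- `E[V (μ k. J)] → E[V z where z := μ k. J]` -/
  | app_mu (E : ECtx) (V : Term) (J : Jump) (hV : V.IsValue) :
      E₀Step (E.plug (app V (mu J))) (E.plug (lets (app V.wk (var 0)) (mu J)))
  /-- `E[(λ x. M) V] → E[M where x := V]` -/
  | beta_lam (E : ECtx) (M V : Term) (hV : V.IsValue) :
      E₀Step (E.plug (app (lam M) V)) (E.plug (lets M V))
  /-- `E[M where x := V] → E[M{V/x}]` -/
  | beta_let (E : ECtx) (M V : Term) (hV : V.IsValue) :
      E₀Step (E.plug (lets M V)) (E.plug (M.subst1 V))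
  /-- `E[M where x := μ k. J] → E[μ k. J{[k]□ ↦ [k](M where x := □)}]` -/
  | beta_mu (E : ECtx) (M : Term) (J : Jump) :
      E₀Step (E.plug (lets M (mu J))) (E.plug (mu (ctxSubst 0 M.wkCont J)))

/-- `Reads J l L`: the jump `J` is `[l]L` once the brackets between jumper and let are placed
in the form `[k](L where x := M)`. Every jump has exactly one such reading. The operational
semantics identifies jumps along the third bracketing axiom and always uses this form; it does
not identify terms along the other two axioms. -/
inductive Reads : Jump → ℕ → Term → Prop
  | jmp (l : ℕ) (L : Term) : Reads (jmp l L) l L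
  | lets {J : Jump} {l : ℕ} {L : Term} (M : Term) (h : Reads J l L) :
      Reads (lets J M) l (lets L M)

/-- The rewriting relation `E`. -/
inductive EStep : Term → Term → Prop
  /-- `μ k. [l] μ m. J → μ k. J{l/m}` -/
  | collapse {J₀ : Jump} {l : ℕ} {J : Jump} (h : Reads J₀ l (mu J)) :
      EStep (mu J₀) (mu (J.substCont l))
  | base {L M : Term} (h : E₀Step L M) : EStep L M
  /-- if `L → M` by `E₀`, then `μ k. [l] L → μ k. [l] M` -/
  | under {J₀ : Jump} {l : ℕ} {L M : Term} (h : Reads J₀ l L) (hs : E₀Step L M) :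
      EStep (mu J₀) (mu (jmp l M))

/-- An `E`-normal form admits no `E`-rewriting. -/
def ENormal (N : Term) : Prop := ∀ P : Term, ¬ EStep N P

/-- The call-by-value evaluation of `M` terminates returning `N`. -/
def EvaluatesTo (M N : Term) : Prop := Relation.ReflTransGen EStep M N ∧ ENormal N

end CCV

namespace CCV

open CCV.Expr

/-! Termination of evaluation is characterised by a denotational semantics that `CcvEq` preserves.
Values and continuations denote filters of intersection types, terms are interpreted in
call-by-value continuation-passing style, and the observations are natural numbers, called answers.
The parameter `τ` of `sem` is the cost charged for each function call and each entry into a `μ`.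

At cost 0 the interpretation is invariant under every axiom and rule (`sem_eq_of_ccvEq`): continuous
functions are represented exactly, which gives the β-rules, and every filter is recovered from the
function it represents, which gives the η-rules. At cost 1, an evaluation step either keeps the
answers and shrinks a syntactic size, or removes one unit of cost (`E₀Step.sem_eq` and the collapse
of nested `μ`s). So an answer at cost 1 forces termination, by lexicographic induction on the answer
and the size (`terminates_of_answers`).

A logical relation defined by recursion on types links the two costs: a term with an answer at cost
0 has one at every cost (`exists_answer`). Finally, if free variables and continuations denote the
greatest elements, an `E`-normal form has every answer at cost 0 (`answers_of_eNormal`), because a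
free variable in head position accepts any call. Hence `N` has an answer at cost 0, so `M'` has one
too, then one at cost 1, and `M'` terminates. The equality of the normal forms only needs that
evaluation is contained in `CcvEq`. -/

/-! ### Intersection types and filter domains -/

/-- Intersection types of values (`Tok true`) and of continuations (`Tok false`). A value of type
`val σ κ n`, called with an argument that has all the types `σ i` and a continuation that has all
the types `κ j`, yields the answer `n`; likewise for a continuation of type `cont σ n`. -/
inductive Tok : Bool → Type
  | val {a b : ℕ} (σ : Fin a → Tok true) (κ : Fin b → Tok false) (n : ℕ) : Tok true
  | cont {a : ℕ} (σ : Fin a → Tok true) (n : ℕ) : Tok false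

/-- The subtyping relation. -/
inductive Tok.Le : {b : Bool} → Tok b → Tok b → Prop
  | val {a b a' b' : ℕ} {σ : Fin a → Tok true} {κ : Fin b → Tok false}
      {σ' : Fin a' → Tok true} {κ' : Fin b' → Tok false} (n : ℕ)
      (f : Fin a → Fin a') (g : Fin b → Fin b')
      (hf : ∀ i, Tok.Le (σ' (f i)) (σ i)) (hg : ∀ j, Tok.Le (κ' (g j)) (κ j)) :
      Tok.Le (.val σ κ n) (.val σ' κ' n)
  | cont {a a' : ℕ} {σ : Fin a → Tok true} {σ' : Fin a' → Tok true} (n : ℕ)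
      (f : Fin a → Fin a') (hf : ∀ i, Tok.Le (σ' (f i)) (σ i)) :
      Tok.Le (.cont σ n) (.cont σ' n)

theorem Tok.Le.refl {b : Bool} (t : Tok b) : Tok.Le t t := by
  induction t with
  | val σ κ n h₁ h₂ => exact .val n id id h₁ h₂
  | cont σ n h => exact .cont n id h

/-- Subtyping is contravariant in the arguments, so composing on one side calls for the induction
hypothesis on the other side; both are proved together. -/
theorem Tok.Le.trans_aux {b : Bool} {s t : Tok b} (h : Tok.Le s t) :
    (∀ u, Tok.Le t u → Tok.Le s u) ∧ ∀ u, Tok.Le u s → Tok.Le u t := by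
  induction h with
  | val n f g _ _ ihf ihg =>
    refine ⟨fun u hu => ?_, fun u hu => ?_⟩
    · cases hu with
      | val _ f' g' hf' hg' =>
        exact .val n (f' ∘ f) (g' ∘ g) (fun i => (ihf i).2 _ (hf' _)) fun i => (ihg i).2 _ (hg' _)
    · cases hu with
      | val _ f' g' hf' hg' =>
        exact .val n (f ∘ f') (g ∘ g') (fun i => (ihf _).1 _ (hf' i)) fun i => (ihg _).1 _ (hg' i)
  | cont n f _ ihf =>
    refine ⟨fun u hu => ?_, fun u hu => ?_⟩
    · cases hu with
      | cont _ f' hf' => exact .cont n (f' ∘ f) fun i => (ihf i).2 _ (hf' _)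
    · cases hu with
      | cont _ f' hf' => exact .cont n (f ∘ f') fun i => (ihf _).1 _ (hf' i)

theorem Tok.Le.trans {b : Bool} {s t u : Tok b} (h : Tok.Le s t) (h' : Tok.Le t u) :
    Tok.Le s u := h.trans_aux.1 _ h'

/-- The filter domain of upper sets of types, with the topology of pointwise convergence in the
Sierpinski space. -/
abbrev Dom (b : Bool) : Type := {A : Tok b → Prop // ∀ s t, Tok.Le s t → A s → A t}

/-- The element generated by finitely many types. -/
def gen {b : Bool} {a : ℕ} (σ : Fin a → Tok b) : Dom b :=
  ⟨fun t => ∃ i, Tok.Le (σ i) t, fun _ _ h ⟨i, hi⟩ => ⟨i, hi.trans h⟩⟩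

theorem mem_gen {b : Bool} {a : ℕ} (σ : Fin a → Tok b) (i : Fin a) : (gen σ).1 (σ i) :=
  ⟨i, .refl _⟩

theorem gen_le {b : Bool} {a : ℕ} {σ : Fin a → Tok b} {A : Dom b} (h : ∀ i, A.1 (σ i)) {t : Tok b}
    (ht : (gen σ).1 t) : A.1 t := by
  obtain ⟨i, hi⟩ := ht
  exact A.2 _ _ hi (h i)

/-- The greatest element. -/
def full (b : Bool) : Dom b := ⟨fun _ => True, fun _ _ _ h => h⟩

/-- The least element. -/
def empty (b : Bool) : Dom b := ⟨fun _ => False, fun _ _ _ h => h⟩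

/-! ### Continuity and finite approximation -/

section Continuity

variable {X : Type} [TopologicalSpace X]

theorem continuous_exists {ι : Sort*} {p : ι → X → Prop} (h : ∀ i, Continuous (p i)) :
    Continuous fun x => ∃ i, p i x := by
  simp only [continuous_Prop] at *
  simpa [Set.ofPred_exists] using isOpen_iUnion h

theorem continuous_and {p q : X → Prop} (hp : Continuous p) (hq : Continuous q) :
    Continuous fun x => p x ∧ q x := by
  simp only [continuous_Prop] at *
  exact hp.inter hq

theorem continuous_forall_fin {a : ℕ} {p : Fin a → X → Prop} (h : ∀ i, Continuous (p i)) :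
    Continuous fun x => ∀ i, p i x := by
  simp only [continuous_Prop] at *
  simpa [Set.ofPred_forall] using isOpen_iInter_of_finite h

theorem continuous_mem {b : Bool} {A : X → Dom b} (hA : Continuous A) (t : Tok b) :
    Continuous fun x => (A x).1 t :=
  (continuous_apply t).comp (continuous_subtype_val.comp hA)

theorem true_mem_of_isOpen {u : Set Prop} (hu : IsOpen u) (h : False ∈ u) : True ∈ u := by
  induction hu with
  | basic s hs => simp_all
  | univ => trivial
  | inter s t _ _ hs ht => exact ⟨hs h.1, ht h.2⟩
  | sUnion S _ ih =>
    obtain ⟨s, hs, hsf⟩ := h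
    exact ⟨s, hs, ih s hs hsf⟩

/-- A basic neighbourhood of `A` in the product constrains finitely many types only. Those outside
`A` may be dropped, since an open set of the Sierpinski space that contains `False` is everything.
-/
theorem exists_gen_of_continuous {b : Bool} {f : Dom b → Prop} (hf : Continuous f) {A : Dom b}
    (h : f A) : ∃ (a : ℕ) (σ : Fin a → Tok b), (∀ i, A.1 (σ i)) ∧
      ∀ B : Dom b, (∀ i, B.1 (σ i)) → f B := by
  classical
  rw [continuous_Prop] at hf
  obtain ⟨U, hU, hUf⟩ := isOpen_induced_iff.1 hf
  have hAU : A.1 ∈ U := by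
    have : A ∈ Subtype.val ⁻¹' U := hUf ▸ h
    exact this
  obtain ⟨I, u, hu, hsub⟩ := isOpen_pi_iff.1 hU A.1 hAU
  let K : Finset (Tok b) := I.filter A.1
  refine ⟨K.card, fun i => (K.equivFin.symm i).1, fun i => ?_, fun B hB => ?_⟩
  · exact (Finset.mem_filter.1 (K.equivFin.symm i).2).2
  · have : B ∈ Subtype.val ⁻¹' U := by
      refine hsub fun t ht => ?_
      by_cases hAt : A.1 t
      · have htK : t ∈ K := Finset.mem_filter.2 ⟨ht, hAt⟩
        have hBt : B.1 t := by simpa using hB (K.equivFin ⟨t, htK⟩)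
        have := (hu t ht).2
        rwa [eq_true hAt, ← eq_true hBt] at this
      · have h2 := (hu t ht).2
        rw [eq_false hAt] at h2
        by_cases hBt : B.1 t
        · rw [eq_true hBt]
          exact true_mem_of_isOpen (hu t ht).1 h2
        · rwa [eq_false hBt]
    rw [hUf] at this
    exact this

end Continuity

theorem iff_exists_gen {b : Bool} {f : Dom b → Prop} (hf : Continuous f) {A : Dom b} :
    f A ↔ ∃ (a : ℕ) (σ : Fin a → Tok b), (∀ i, A.1 (σ i)) ∧ f (gen σ) := by
  refine ⟨fun h => ?_, fun ⟨a, σ, hσ, h⟩ => ?_⟩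
  · obtain ⟨a, σ, hσ, h⟩ := exists_gen_of_continuous hf h
    exact ⟨a, σ, hσ, h _ (mem_gen σ)⟩
  · obtain ⟨a', σ', hσ', h'⟩ := exists_gen_of_continuous hf h
    exact h' A fun i => gen_le hσ (hσ' i)

theorem mono_of_continuous {b : Bool} {f : Dom b → Prop} (hf : Continuous f) {A B : Dom b}
    (h : ∀ t, A.1 t → B.1 t) (hA : f A) : f B := by
  obtain ⟨a, σ, hσ, h'⟩ := exists_gen_of_continuous hf hA
  exact h' B fun i => h _ (hσ i)

/-! ### Filters as continuous functions -/

/-- The continuation `c` accepts the value `A`, with answer `n`. -/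
def accept (c : Dom false) (A : Dom true) (n : ℕ) : Prop :=
  ∃ (a : ℕ) (σ : Fin a → Tok true), c.1 (.cont σ n) ∧ ∀ i, A.1 (σ i)

/-- The value `A`, called with argument `B` and continuation `c`, yields the answer `n`. -/
def call (A B : Dom true) (c : Dom false) (n : ℕ) : Prop :=
  ∃ (a b : ℕ) (σ : Fin a → Tok true) (κ : Fin b → Tok false),
    A.1 (.val σ κ n) ∧ (∀ i, B.1 (σ i)) ∧ ∀ j, c.1 (κ j)

/-- The continuation that represents a continuous function. -/
def cont (f : Dom true → ℕ → Prop) : Dom false :=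
  ⟨fun t => ∃ (a : ℕ) (σ : Fin a → Tok true) (n : ℕ), Tok.Le (.cont σ n) t ∧ f (gen σ) n,
    fun _ _ h ⟨a, σ, n, h', hf⟩ => ⟨a, σ, n, h'.trans h, hf⟩⟩

/-- The value that represents a continuous function. -/
def abs (f : Dom true → Dom false → ℕ → Prop) : Dom true :=
  ⟨fun t => ∃ (a b : ℕ) (σ : Fin a → Tok true) (κ : Fin b → Tok false) (n : ℕ),
      Tok.Le (.val σ κ n) t ∧ f (gen σ) (gen κ) n,
    fun _ _ h ⟨a, b, σ, κ, n, h', hf⟩ => ⟨a, b, σ, κ, n, h'.trans h, hf⟩⟩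

/-- The answer `n` of `f`, delayed by `τ`. -/
def tick (τ : ℕ) (f : ℕ → Prop) (n : ℕ) : Prop := τ ≤ n ∧ f (n - τ)

@[simp] theorem tick_zero (f : ℕ → Prop) : tick 0 f = f := by
  funext n; simp [tick]

theorem cont_mem {f : Dom true → ℕ → Prop} (hf : ∀ n, Continuous fun A => f A n) {a : ℕ}
    {σ : Fin a → Tok true} {n : ℕ} : (cont f).1 (.cont σ n) ↔ f (gen σ) n := by
  refine ⟨fun ⟨a', σ', n', h, hf'⟩ => ?_, fun h => ⟨a, σ, n, .refl _, h⟩⟩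
  cases h with
  | cont _ g hg => exact mono_of_continuous (hf n) (fun t => gen_le (A := gen _) fun i => ⟨g i, hg i⟩) hf'

theorem abs_mem {f : Dom true → Dom false → ℕ → Prop}
    (hf₁ : ∀ n c, Continuous fun A => f A c n) (hf₂ : ∀ n A, Continuous fun c => f A c n)
    {a b : ℕ} {σ : Fin a → Tok true} {κ : Fin b → Tok false} {n : ℕ} :
    (abs f).1 (.val σ κ n) ↔ f (gen σ) (gen κ) n := by
  refine ⟨fun ⟨a', b', σ', κ', n', h, hf'⟩ => ?_, fun h => ⟨a, b, σ, κ, n, .refl _, h⟩⟩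
  cases h with
  | val _ g g' hg hg' =>
    exact mono_of_continuous (hf₁ n _) (fun t => gen_le (A := gen _) fun i => ⟨g i, hg i⟩)
      (mono_of_continuous (hf₂ n _) (fun t => gen_le (A := gen _) fun i => ⟨g' i, hg' i⟩) hf')

/-- This is the β-law: a continuous function is determined by its values at finitely generated
filters, which are what types record. -/
theorem accept_cont {f : Dom true → ℕ → Prop} (hf : ∀ n, Continuous fun A => f A n) :
    accept (cont f) = f := by
  funext A n
  refine propext ?_
  rw [iff_exists_gen (hf n)]
  simp only [accept, cont_mem hf, and_comm]

theorem call_abs {f : Dom true → Dom false → ℕ → Prop}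
    (hf₁ : ∀ n c, Continuous fun A => f A c n) (hf₂ : ∀ n A, Continuous fun c => f A c n) :
    call (abs f) = f := by
  funext A c n
  refine propext ?_
  simp only [call, abs_mem hf₁ hf₂]
  constructor
  · rintro ⟨a, b, σ, κ, h, hA, hc⟩
    exact mono_of_continuous (hf₁ n _) (fun t => gen_le hA)
      (mono_of_continuous (hf₂ n _) (fun t => gen_le hc) h)
  · intro h
    obtain ⟨a, σ, hA, h⟩ := (iff_exists_gen (hf₁ n _)).1 h
    obtain ⟨b, κ, hc, h⟩ := (iff_exists_gen (hf₂ n _)).1 h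
    exact ⟨a, b, σ, κ, h, hA, hc⟩

/-- This is the η-law. It is exact because filters are closed under subtyping: a type that the
represented function satisfies lies above one already in `c`. -/
theorem cont_accept (c : Dom false) : cont (accept c) = c := by
  refine Subtype.ext (funext fun t => propext ⟨?_, fun h => ?_⟩)
  · rintro ⟨a, σ, n, h, a', σ', hc, h'⟩
    refine c.2 _ _ (.trans ?_ h) hc
    choose f hf using h'
    exact .cont n f hf
  · cases t with
    | cont σ n => exact ⟨_, σ, n, .refl _, _, σ, h, mem_gen σ⟩

theorem abs_call (A : Dom true) : abs (call A) = A := by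
  refine Subtype.ext (funext fun t => propext ⟨?_, fun h => ?_⟩)
  · rintro ⟨a, b, σ, κ, n, h, a', b', σ', κ', hA, h', h''⟩
    refine A.2 _ _ (.trans ?_ h) hA
    choose f hf using h'
    choose g hg using h''
    exact .val n f g hf hg
  · cases t with
    | val σ κ n => exact ⟨_, _, σ, κ, n, .refl _, _, _, σ, κ, h, mem_gen σ, mem_gen κ⟩

/-- Extension of an environment. -/
def cons {α : Type} (a : α) (ρ : ℕ → α) : ℕ → α
  | 0 => a
  | n + 1 => ρ n

theorem cons_up {α : Type} (a : α) (ρ : ℕ → α) (r : ℕ → ℕ) : cons a ρ ∘ up r = cons a (ρ ∘ r) := by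
  funext n; cases n <;> rfl

theorem cons_succ {α : Type} (a : α) (ρ : ℕ → α) : cons a ρ ∘ Nat.succ = ρ := rfl

theorem cons_inst {α : Type} (ρ : ℕ → α) (l : ℕ) : ρ ∘ inst l = cons (ρ l) ρ := by
  funext n; cases n <;> rfl

theorem cons_const {α : Type} (a : α) : cons a (fun _ => a) = fun _ => a := by
  funext n; cases n <;> rfl

section Continuity

variable {X : Type} [TopologicalSpace X]

theorem continuous_dom {b : Bool} {A : X → Dom b} (h : ∀ t, Continuous fun x => (A x).1 t) :
    Continuous A :=
  Continuous.subtype_mk (continuous_pi h) _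

theorem continuous_accept {c : X → Dom false} {A : X → Dom true} (hc : Continuous c)
    (hA : Continuous A) (n : ℕ) : Continuous fun x => accept (c x) (A x) n :=
  continuous_exists fun _ => continuous_exists fun _ => continuous_and (continuous_mem hc _)
    (continuous_forall_fin fun _ => continuous_mem hA _)

theorem continuous_call {A B : X → Dom true} {c : X → Dom false} (hA : Continuous A)
    (hB : Continuous B) (hc : Continuous c) (n : ℕ) :
    Continuous fun x => call (A x) (B x) (c x) n :=
  continuous_exists fun _ => continuous_exists fun _ => continuous_exists fun _ =>
    continuous_exists fun _ => continuous_and (continuous_mem hA _) (continuous_and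
      (continuous_forall_fin fun _ => continuous_mem hB _)
      (continuous_forall_fin fun _ => continuous_mem hc _))

theorem continuous_cont {f : X → Dom true → ℕ → Prop} (hf : ∀ A n, Continuous fun x => f x A n) :
    Continuous fun x => cont (f x) :=
  continuous_dom fun _ => continuous_exists fun _ => continuous_exists fun _ =>
    continuous_exists fun _ => continuous_and continuous_const (hf _ _)

theorem continuous_abs {f : X → Dom true → Dom false → ℕ → Prop}
    (hf : ∀ A c n, Continuous fun x => f x A c n) : Continuous fun x => abs (f x) :=
  continuous_dom fun _ => continuous_exists fun _ => continuous_exists fun _ =>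
    continuous_exists fun _ => continuous_exists fun _ => continuous_exists fun _ =>
      continuous_and continuous_const (hf _ _ _)

theorem continuous_tick (τ : ℕ) {f : X → ℕ → Prop} (hf : ∀ n, Continuous fun x => f x n) (n : ℕ) :
    Continuous fun x => tick τ (f x) n :=
  continuous_and continuous_const (hf _)

theorem continuous_cons {α : Type} [TopologicalSpace α] {a : X → α} {ρ : X → ℕ → α}
    (ha : Continuous a) (hρ : Continuous ρ) : Continuous fun x => cons (a x) (ρ x) := by
  refine continuous_pi fun n => ?_
  cases n with
  | zero => exact ha
  | succ n => exact (continuous_apply n).comp hρ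

end Continuity

/-! ### Continuation-passing semantics with costs -/

/-- The answers of an expression, in environments for the ordinary and for the continuation
variables, under a continuation (jumps ignore it). Entering a `μ`-abstraction and calling a
function each cost `τ`. -/
def sem (τ : ℕ) : {s : Kind} → Expr s → (ℕ → Dom true) → (ℕ → Dom false) → Dom false → ℕ → Prop
  | _, var x, ρ, _, c => accept c (ρ x)
  | _, lam M, ρ, δ, c => accept c (abs fun A k => sem τ M (cons A ρ) δ k)
  | _, app M N, ρ, δ, c =>
      sem τ M ρ δ (cont fun A => sem τ N ρ δ (cont fun B => tick τ (call A B c)))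
  | _, mu J, ρ, δ, c => tick τ (sem τ J ρ (cons c δ) (empty false))
  | _, jmp k M, ρ, δ, _ => sem τ M ρ δ (δ k)
  | _, lets L M, ρ, δ, c => sem τ M ρ δ (cont fun A => sem τ L (cons A ρ) δ c)

/-- All inputs vary over an arbitrary space `X`, so the induction passes under binders and
continuity in each variable separately is a special case. -/
theorem continuous_sem (τ : ℕ) {s : Kind} (P : Expr s) {X : Type} [TopologicalSpace X]
    {ρ : X → ℕ → Dom true} {δ : X → ℕ → Dom false} {c : X → Dom false} (hρ : Continuous ρ)
    (hδ : Continuous δ) (hc : Continuous c) (n : ℕ) :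
    Continuous fun x => sem τ P (ρ x) (δ x) (c x) n := by
  induction P generalizing ρ δ c n with
  | var x => exact continuous_accept hc ((continuous_apply x).comp hρ) n
  | lam M ih =>
    exact continuous_accept hc (continuous_abs fun A k m =>
      ih (continuous_cons continuous_const hρ) hδ continuous_const m) n
  | app M N ihM ihN =>
    exact ihM hρ hδ (continuous_cont fun A m => ihN hρ hδ (continuous_cont fun B l =>
      continuous_tick τ (continuous_call continuous_const continuous_const hc) l) m) n
  | mu J ih => exact continuous_tick τ (ih hρ (continuous_cons hc hδ) continuous_const) n
  | jmp k M ih => exact ih hρ hδ ((continuous_apply k).comp hδ) n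
  | lets L M ihL ihM =>
    exact ihM hρ hδ (continuous_cont fun A m =>
      ihL (continuous_cons continuous_const hρ) hδ hc m) n

theorem sem_rename (τ : ℕ) {s : Kind} (P : Expr s) (r q : ℕ → ℕ) (ρ : ℕ → Dom true)
    (δ : ℕ → Dom false) (c : Dom false) :
    sem τ (P.rename r q) ρ δ c = sem τ P (ρ ∘ r) (δ ∘ q) c := by
  induction P generalizing r q ρ δ c with
  | var x => rfl
  | lam M ih => simp only [Expr.rename, sem, ih, cons_up]
  | app M N ihM ihN => simp only [Expr.rename, sem, ihM, ihN]
  | mu J ih => simp only [Expr.rename, sem, ih, cons_up]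
  | jmp k M ih => simp only [Expr.rename, sem, ih, Function.comp]
  | lets L M ihL ihM => simp only [Expr.rename, sem, ihL, ihM, cons_up]

@[simp] theorem sem_wk (τ : ℕ) {s : Kind} (P : Expr s) (A : Dom true) (ρ : ℕ → Dom true)
    (δ : ℕ → Dom false) (c : Dom false) : sem τ P.wk (cons A ρ) δ c = sem τ P ρ δ c :=
  sem_rename τ P _ _ _ _ _

@[simp] theorem sem_wkUnder (τ : ℕ) {s : Kind} (P : Expr s) (A B : Dom true) (ρ : ℕ → Dom true)
    (δ : ℕ → Dom false) (c : Dom false) :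
    sem τ P.wkUnder (cons A (cons B ρ)) δ c = sem τ P (cons A ρ) δ c := by
  rw [wkUnder, sem_rename, cons_up, cons_succ]; rfl

@[simp] theorem sem_wkCont (τ : ℕ) {s : Kind} (P : Expr s) (k : Dom false) (ρ : ℕ → Dom true)
    (δ : ℕ → Dom false) (c : Dom false) : sem τ P.wkCont ρ (cons k δ) c = sem τ P ρ δ c :=
  sem_rename τ P _ _ _ _ _

/-! ### Semantics of values, substitution and the reduction rules -/

/-- The denotation of a value. -/
def valSem (τ : ℕ) (ρ : ℕ → Dom true) (δ : ℕ → Dom false) : Term → Dom true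
  | var x => ρ x
  | lam M => abs fun A k => sem τ M (cons A ρ) δ k
  | _ => empty true

theorem sem_of_isValue (τ : ℕ) {V : Term} (hV : V.IsValue) (ρ : ℕ → Dom true) (δ : ℕ → Dom false)
    (c : Dom false) : sem τ V ρ δ c = accept c (valSem τ ρ δ V) := by
  cases V <;> first | rfl | exact hV.elim

theorem isValue_rename {V : Term} (hV : V.IsValue) (r q : ℕ → ℕ) : (V.rename r q).IsValue := by
  cases V <;> trivial

theorem valSem_rename (τ : ℕ) (V : Term) (r q : ℕ → ℕ) (ρ : ℕ → Dom true)
    (δ : ℕ → Dom false) : valSem τ ρ δ (V.rename r q) = valSem τ (ρ ∘ r) (δ ∘ q) V := by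
  cases V <;> simp only [Expr.rename, valSem, sem_rename, cons_up, Function.comp]

theorem isValue_upSubst {σ : ℕ → Term} (hσ : ∀ x, (σ x).IsValue) (x : ℕ) :
    (upSubst σ x).IsValue := by
  cases x with
  | zero => trivial
  | succ x => exact isValue_rename (hσ x) _ _

theorem valSem_upSubst (τ : ℕ) (σ : ℕ → Term) (A : Dom true) (ρ : ℕ → Dom true)
    (δ : ℕ → Dom false) : (fun x => valSem τ (cons A ρ) δ (upSubst σ x)) =
      cons A fun x => valSem τ ρ δ (σ x) := by
  funext x
  cases x with
  | zero => rfl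
  | succ x => exact valSem_rename τ (σ x) _ _ _ _

theorem sem_subst (τ : ℕ) {s : Kind} (P : Expr s) {σ : ℕ → Term} (hσ : ∀ x, (σ x).IsValue)
    (ρ : ℕ → Dom true) (δ : ℕ → Dom false) (c : Dom false) :
    sem τ (P.subst σ) ρ δ c = sem τ P (fun x => valSem τ ρ δ (σ x)) δ c := by
  induction P generalizing σ ρ δ c with
  | var x => exact sem_of_isValue τ (hσ x) ρ δ c
  | lam M ih => simp only [Expr.subst, sem, ih (isValue_upSubst hσ), valSem_upSubst]
  | app M N ihM ihN => simp only [Expr.subst, sem, ihM hσ, ihN hσ]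
  | mu J ih =>
    simp only [Expr.subst, sem, ih fun x => isValue_rename (hσ x) _ _, wkCont, valSem_rename,
      cons_succ, Function.comp_id]
  | jmp k M ih => simp only [Expr.subst, sem, ih hσ]
  | lets L M ihL ihM =>
    simp only [Expr.subst, sem, ihM hσ, ihL (isValue_upSubst hσ), valSem_upSubst]

theorem isValue_single {V : Term} (hV : V.IsValue) (x : ℕ) : (single V x).IsValue := by
  cases x with
  | zero => exact hV
  | succ x => trivial

theorem sem_subst1 (τ : ℕ) {s : Kind} (P : Expr s) {V : Term} (hV : V.IsValue)
    (ρ : ℕ → Dom true) (δ : ℕ → Dom false) (c : Dom false) :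
    sem τ (P.subst1 V) ρ δ c = sem τ P (cons (valSem τ ρ δ V) ρ) δ c := by
  rw [subst1, sem_subst τ P (isValue_single hV)]
  congr 1
  funext x
  cases x <;> rfl

theorem cons_update (k : ℕ) (c d : Dom false) (δ : ℕ → Dom false) :
    Function.update (cons c δ) (k + 1) d = cons c (Function.update δ k d) := by
  funext x
  cases x with
  | zero => simp [cons]
  | succ x => by_cases h : x = k <;> simp [cons, h]

/-- The replaced jumps still target `k`, so the new continuation at `k` runs `M` and then passes on
to the old `δ k`. -/
theorem sem_ctxSubst (τ : ℕ) {s : Kind} (P : Expr s) (k : ℕ) (M : Term) (ρ : ℕ → Dom true)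
    (δ : ℕ → Dom false) (c : Dom false) :
    sem τ (ctxSubst k M P) ρ δ c =
      sem τ P ρ (Function.update δ k (cont fun A => sem τ M (cons A ρ) δ (δ k))) c := by
  induction P generalizing k M ρ δ c with
  | var x => rfl
  | lam P ih => simp only [ctxSubst, sem, ih, sem_wkUnder]
  | app P Q ihP ihQ => simp only [ctxSubst, sem, ihP, ihQ]
  | mu J ih => simp only [ctxSubst, sem, ih, sem_wkCont, cons_update, cons]
  | jmp l Q ih =>
    by_cases h : l = k
    · simp [ctxSubst, sem, ih, h]
    · simp [ctxSubst, sem, ih, h]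
  | lets L Q ihL ihQ => simp only [ctxSubst, sem, ihL, ihQ, sem_wkUnder]

/-- The kind is kept general, with an equation, so that induction over the indexed family of
expressions applies. -/
theorem sem_jump (τ : ℕ) {s : Kind} (P : Expr s) (hs : s = .jump) (ρ : ℕ → Dom true)
    (δ : ℕ → Dom false) (c d : Dom false) : sem τ P ρ δ c = sem τ P ρ δ d := by
  induction P generalizing ρ δ c d with
  | jmp => rfl
  | lets L M ihL =>
    simp only [sem]
    congr 1
    congr 1
    funext A
    exact ihL hs _ _ _ _
  | _ => cases hs

theorem accept_cont_sem (τ : ℕ) {s : Kind} (L : Expr s) (ρ : ℕ → Dom true) (δ : ℕ → Dom false)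
    (c : Dom false) :
    accept (cont fun A => sem τ L (cons A ρ) δ c) = fun A => sem τ L (cons A ρ) δ c :=
  accept_cont fun n => continuous_sem τ L (continuous_cons continuous_id continuous_const)
    continuous_const continuous_const n

theorem accept_cont_call (τ : ℕ) (A : Dom true) (c : Dom false) :
    accept (cont fun B => tick τ (call A B c)) = fun B => tick τ (call A B c) :=
  accept_cont fun n => continuous_tick τ (continuous_call continuous_const continuous_id
    continuous_const) n

theorem call_abs_sem (τ : ℕ) (M : Term) (ρ : ℕ → Dom true) (δ : ℕ → Dom false) :
    call (abs fun A k => sem τ M (cons A ρ) δ k) = fun A k => sem τ M (cons A ρ) δ k :=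
  call_abs
    (fun n _ => continuous_sem τ M (continuous_cons continuous_id continuous_const)
      continuous_const continuous_const n)
    fun n _ => continuous_sem τ M continuous_const continuous_const continuous_id n

theorem sem_app_left_value (τ : ℕ) {V : Term} (hV : V.IsValue) (N : Term) (ρ : ℕ → Dom true)
    (δ : ℕ → Dom false) (c : Dom false) :
    sem τ (app V N) ρ δ c =
      sem τ N ρ δ (cont fun B => tick τ (call (valSem τ ρ δ V) B c)) := by
  rw [sem, sem_of_isValue τ hV, accept_cont]
  exact fun n => continuous_sem τ N continuous_const continuous_const
    (continuous_cont fun B l => continuous_tick τ (continuous_call continuous_id continuous_const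
      continuous_const) l) n

theorem sem_app_values (τ : ℕ) {V W : Term} (hV : V.IsValue) (hW : W.IsValue) (ρ : ℕ → Dom true)
    (δ : ℕ → Dom false) (c : Dom false) :
    sem τ (app V W) ρ δ c = tick τ (call (valSem τ ρ δ V) (valSem τ ρ δ W) c) := by
  rw [sem_app_left_value τ hV, sem_of_isValue τ hW, accept_cont_call]

theorem sem_lets_value (τ : ℕ) {s : Kind} (L : Expr s) {V : Term} (hV : V.IsValue)
    (ρ : ℕ → Dom true) (δ : ℕ → Dom false) (c : Dom false) :
    sem τ (lets L V) ρ δ c = sem τ L (cons (valSem τ ρ δ V) ρ) δ c := by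
  rw [sem, sem_of_isValue τ hV, accept_cont_sem]

/-- Naming the operator keeps the order of evaluation and makes the same calls, so the equation
holds at every cost. -/
theorem sem_let_left (τ : ℕ) (N M : Term) (ρ : ℕ → Dom true) (δ : ℕ → Dom false) (c : Dom false) :
    sem τ (lets (app (var 0) M.wk) N) ρ δ c = sem τ (app N M) ρ δ c := by
  simp only [sem.eq_6, sem_app_left_value τ (V := var 0) trivial, valSem, sem_wk]
  rfl

theorem isValue_wk {V : Term} (hV : V.IsValue) : V.wk.IsValue := isValue_rename hV _ _

@[simp] theorem valSem_wk (τ : ℕ) (V : Term) (A : Dom true) (ρ : ℕ → Dom true)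
    (δ : ℕ → Dom false) : valSem τ (cons A ρ) δ V.wk = valSem τ ρ δ V :=
  valSem_rename τ V _ _ _ _

theorem sem_let_right (τ : ℕ) {V : Term} (hV : V.IsValue) (N : Term) (ρ : ℕ → Dom true)
    (δ : ℕ → Dom false) (c : Dom false) :
    sem τ (lets (app V.wk (var 0)) N) ρ δ c = sem τ (app V N) ρ δ c := by
  rw [sem_app_left_value τ hV]
  simp only [sem.eq_6, sem_app_values τ (isValue_wk hV) (W := var 0) trivial, valSem_wk]
  rfl

theorem sem_app_lam (τ : ℕ) (M : Term) {V : Term} (hV : V.IsValue) (ρ : ℕ → Dom true)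
    (δ : ℕ → Dom false) (c : Dom false) :
    sem τ (app (lam M) V) ρ δ c = tick τ (sem τ (lets M V) ρ δ c) := by
  rw [sem_app_values τ (V := lam M) trivial hV, sem_lets_value τ M hV, valSem, call_abs_sem]

theorem sem_lets_subst (τ : ℕ) {s : Kind} (L : Expr s) {V : Term} (hV : V.IsValue)
    (ρ : ℕ → Dom true) (δ : ℕ → Dom false) (c : Dom false) :
    sem τ (lets L V) ρ δ c = sem τ (L.subst1 V) ρ δ c := by
  rw [sem_lets_value τ L hV, sem_subst1 τ L hV]

theorem sem_lets_mu (τ : ℕ) (M : Term) (J : Jump) (ρ : ℕ → Dom true) (δ : ℕ → Dom false)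
    (c : Dom false) :
    sem τ (lets M (mu J)) ρ δ c = sem τ (mu (ctxSubst 0 M.wkCont J)) ρ δ c := by
  simp only [sem, sem_ctxSubst, sem_wkCont]
  congr 2
  funext x
  cases x <;> rfl

theorem sem_substCont (τ : ℕ) (J : Jump) (l : ℕ) (ρ : ℕ → Dom true) (δ : ℕ → Dom false)
    (c d : Dom false) : sem τ (J.substCont l) ρ δ c = sem τ J ρ (cons (δ l) δ) d := by
  rw [substCont, sem_rename, cons_inst]
  exact sem_jump τ J rfl _ _ _ _

/-! ### Invariance under the equality at cost zero -/

/-- The cost must vanish here: moving a `μ` out of a let charges it before `M` runs, even if `M`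
never uses its continuation. -/
theorem sem_eq_of_bracketAx {s : Kind} {P Q : Expr s} (h : BracketAx P Q) (ρ : ℕ → Dom true)
    (δ : ℕ → Dom false) (c : Dom false) : sem 0 P ρ δ c = sem 0 Q ρ δ c := by
  cases h with
  | assoc L M N => simp only [sem, sem_wkUnder]
  | mu_lets J M => simp only [sem, sem_wkCont, tick_zero]
  | jmp_lets k L M => rfl

theorem sem_eq_of_red {s : Kind} {P Q : Expr s} (h : Red P Q) (ρ : ℕ → Dom true)
    (δ : ℕ → Dom false) (c : Dom false) : sem 0 P ρ δ c = sem 0 Q ρ δ c := by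
  cases h with
  | ad₁ N M => exact (sem_let_left 0 N M ρ δ c).symm
  | ad₂ V N hV => exact (sem_let_right 0 hV N ρ δ c).symm
  | beta_lam M V hV => rw [sem_app_lam 0 M hV, tick_zero]
  | beta_let M V hV => exact sem_lets_subst 0 _ hV ρ δ c
  | beta_mu M J => exact sem_lets_mu 0 M J ρ δ c
  | beta_jmp l J => simp only [sem, tick_zero, sem_substCont 0 J l ρ δ c (empty false)]
  | eta_lam V hV =>
    rw [sem_of_isValue 0 hV]
    simp only [sem.eq_2, sem_app_values 0 (isValue_wk hV) (W := var 0) trivial, valSem_wk,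
      tick_zero]
    exact congrArg _ (abs_call _)
  | eta_let M => exact congrArg _ (cont_accept c)
  | eta_mu M => simp only [sem, tick_zero, sem_wkCont, cons]

theorem sem_eq_of_ccvEq {s : Kind} {P Q : Expr s} (h : CcvEq P Q) (ρ : ℕ → Dom true)
    (δ : ℕ → Dom false) (c : Dom false) : sem 0 P ρ δ c = sem 0 Q ρ δ c := by
  induction h generalizing ρ δ c with
  | bracket h => exact sem_eq_of_bracketAx h ρ δ c
  | red h => exact sem_eq_of_red h ρ δ c
  | refl => rfl
  | symm _ ih => exact (ih ρ δ c).symm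
  | trans _ _ ih₁ ih₂ => exact (ih₁ ρ δ c).trans (ih₂ ρ δ c)
  | lam _ ih => simp only [sem, ih]
  | app _ _ ih₁ ih₂ => simp only [sem, ih₁, ih₂]
  | mu _ ih => simp only [sem, ih]
  | jmp k _ ih => simp only [sem, ih]
  | lets _ _ ih₁ ih₂ => simp only [sem, ih₁, ih₂]

/-! ### Logical relation between the costs -/

/-- The elements that have a given type, up to the cost of the answers. -/
def Sat : {b : Bool} → Tok b → Dom b → Prop
  -- The answer stored in the type is forgotten, because costs change it. The recursion is on the
  -- type, so the reflexive domain raises no circularity.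
  | _, .val σ κ _, A => ∀ (B : Dom true) (c : Dom false), (∀ i, Sat (σ i) B) →
      (∀ j, Sat (κ j) c) → ∃ n, call A B c n
  | _, .cont σ _, c => ∀ B : Dom true, (∀ i, Sat (σ i) B) → ∃ n, accept c B n

theorem Sat.mono {b : Bool} {s t : Tok b} (h : Tok.Le s t) {A : Dom b} (hs : Sat s A) :
    Sat t A := by
  induction h with
  | val n f g _ _ ihf ihg =>
    exact fun B c hB hc => hs B c (fun i => ihf i (hB _)) fun j => ihg j (hc _)
  | cont n f _ ihf => exact fun B hB => hs B fun i => ihf i (hB _)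

/-- The second element has all the types that belong to the first one. -/
def Refines {b : Bool} (A B : Dom b) : Prop := ∀ t, A.1 t → Sat t B

theorem refines_gen {b : Bool} {a : ℕ} {σ : Fin a → Tok b} {A : Dom b} (h : ∀ i, Sat (σ i) A) :
    Refines (gen σ) A := fun _ ⟨i, hi⟩ => (h i).mono hi

theorem refines_cons {b : Bool} {A B : Dom b} {ρ ρ' : ℕ → Dom b} (h : Refines A B)
    (hρ : ∀ x, Refines (ρ x) (ρ' x)) (x : ℕ) : Refines (cons A ρ x) (cons B ρ' x) := by
  cases x with
  | zero => exact h
  | succ x => exact hρ x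

theorem Refines.accept {A A' : Dom true} {c c' : Dom false} (hA : Refines A A')
    (hc : Refines c c') {n : ℕ} (h : accept c A n) : ∃ m, CCV.accept c' A' m := by
  obtain ⟨a, σ, h, hσ⟩ := h
  exact hc _ h A' fun i => hA _ (hσ i)

theorem refines_cont {f g : Dom true → ℕ → Prop} (hg : ∀ n, Continuous fun A => g A n)
    (h : ∀ A B n, Refines A B → f A n → ∃ m, g B m) : Refines (cont f) (cont g) := by
  rintro t ⟨a, σ, n, ht, hf⟩
  refine Sat.mono ht fun B hB => ?_
  rw [accept_cont hg]
  exact h _ B n (refines_gen hB) hf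

theorem refines_abs {f g : Dom true → Dom false → ℕ → Prop}
    (hg₁ : ∀ n c, Continuous fun A => g A c n) (hg₂ : ∀ n A, Continuous fun c => g A c n)
    (h : ∀ A B c d n, Refines A B → Refines c d → f A c n → ∃ m, g B d m) :
    Refines (abs f) (abs g) := by
  rintro t ⟨a, b, σ, κ, n, ht, hf⟩
  refine Sat.mono ht fun B c hB hc => ?_
  rw [call_abs hg₁ hg₂]
  exact h _ B _ c n (refines_gen hB) (refines_gen hc) hf

theorem exists_tick (τ : ℕ) {f : ℕ → Prop} (h : ∃ n, f n) : ∃ n, tick τ f n := by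
  obtain ⟨n, hn⟩ := h
  exact ⟨n + τ, by simpa [tick] using hn⟩

/-- The fundamental lemma of the logical relation: each construct preserves the relation, and a tick
only shifts an answer. -/
theorem exists_sem_of_refines (τ : ℕ) {s : Kind} (P : Expr s) {ρ ρ' : ℕ → Dom true}
    {δ δ' : ℕ → Dom false} {c c' : Dom false} (hρ : ∀ x, Refines (ρ x) (ρ' x))
    (hδ : ∀ k, Refines (δ k) (δ' k)) (hc : Refines c c') {n : ℕ} (h : sem 0 P ρ δ c n) :
    ∃ m, sem τ P ρ' δ' c' m := by
  induction P generalizing ρ ρ' δ δ' c c' n with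
  | var x => exact (hρ x).accept hc h
  | lam M ih =>
    refine Refines.accept (refines_abs ?_ ?_ ?_) hc h
    · exact fun n _ => continuous_sem τ M (continuous_cons continuous_id continuous_const)
        continuous_const continuous_const n
    · exact fun n _ => continuous_sem τ M continuous_const continuous_const continuous_id n
    · exact fun A B c d n hA hc h => ih (refines_cons hA hρ) hδ hc h
  | app M N ihM ihN =>
    refine ihM hρ hδ (refines_cont ?_ fun A A' m hA h => ihN hρ hδ (refines_cont ?_ ?_) h) h
    · exact fun n => continuous_sem τ N continuous_const continuous_const
        (continuous_cont fun B l => continuous_tick τ (continuous_call continuous_id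
          continuous_const continuous_const) l) n
    · exact fun n => continuous_tick τ (continuous_call continuous_const continuous_id
        continuous_const) n
    · intro B B' m hB h
      rw [tick_zero] at h
      obtain ⟨a, b, σ, κ, hf, hσ, hκ⟩ := h
      -- A call at cost 0 uses a single type of `A`, and `A'` satisfies that type.
      exact exists_tick τ (hA _ hf B' c' (fun i => hB _ (hσ i)) fun j => hc _ (hκ j))
  | mu J ih =>
    simp only [sem, tick_zero] at h
    exact exists_tick τ (ih hρ (refines_cons hc hδ) (fun _ h => False.elim h) h)
  | jmp k M ih => exact ih hρ hδ (hδ k) h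
  | lets L M ihL ihM =>
    refine ihM hρ hδ (refines_cont ?_ fun A A' m hA h => ihL (refines_cons hA hρ) hδ hc h) h
    exact fun n => continuous_sem τ L (continuous_cons continuous_id continuous_const)
      continuous_const continuous_const n

theorem sat_full {b : Bool} (t : Tok b) : Sat t (full b) := by
  cases t with
  | val σ κ n =>
    exact fun B c _ _ => ⟨0, 0, 0, Fin.elim0, Fin.elim0, trivial, fun i => i.elim0, fun i => i.elim0⟩
  | cont σ n => exact fun B _ => ⟨0, 0, Fin.elim0, trivial, fun i => i.elim0⟩

/-- The answers of a term under the greatest environments and continuation. -/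
def answers (τ : ℕ) (M : Term) : ℕ → Prop :=
  sem τ M (fun _ => full true) (fun _ => full false) (full false)

theorem exists_answer (τ : ℕ) {M : Term} {n : ℕ} (h : answers 0 M n) : ∃ m, answers τ M m :=
  exists_sem_of_refines τ M (fun _ t _ => sat_full t) (fun _ t _ => sat_full t)
    (fun t _ => sat_full t) h

/-- An evaluation context binds nothing around its hole, so it acts as a continuation that does not
depend on the term plugged in. Equations at the root then suffice. -/
theorem exists_plug_cont (τ : ℕ) (E : ECtx) (ρ : ℕ → Dom true) (δ : ℕ → Dom false)
    (c : Dom false) : ∃ d, ∀ P, sem τ (E.plug P) ρ δ c = sem τ P ρ δ d := by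
  induction E with
  | hole => exact ⟨c, fun P => rfl⟩
  | appR E V hV ih =>
    obtain ⟨d, hd⟩ := ih
    exact ⟨_, fun P => (hd _).trans (sem_app_left_value τ hV P ρ δ d)⟩
  | appL E M ih =>
    obtain ⟨d, hd⟩ := ih
    exact ⟨_, fun P => hd _⟩
  | letArg E M ih =>
    obtain ⟨d, hd⟩ := ih
    exact ⟨_, fun P => hd _⟩

/-! ### A size that decreases on cost-free steps -/

/-- The contribution of the immediate subterms of an application to its size. -/
def weight : Term → ℕ
  | var _ => 0
  | lam _ => 0
  -- Naming a non-value operand creates a let of size 1; the operand loses weight 2, so the size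
  -- drops strictly.
  | _ => 2

theorem weight_of_isValue {V : Term} (hV : V.IsValue) : weight V = 0 := by
  cases V <;> first | rfl | exact hV.elim

theorem weight_of_not_isValue {M : Term} (hM : ¬ M.IsValue) : weight M = 2 := by
  cases M <;> first | rfl | exact (hM trivial).elim

theorem weight_le (M : Term) : weight M ≤ 2 := by
  cases M <;> simp [weight]

theorem weight_rename (M : Term) (r q : ℕ → ℕ) : weight (M.rename r q) = weight M := by
  cases M <;> rfl

theorem weight_subst (M : Term) {σ : ℕ → Term} (hσ : ∀ x, (σ x).IsValue) :
    weight (M.subst σ) = weight M := by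
  cases M with
  | var x => exact weight_of_isValue (hσ x)
  | _ => rfl

/-- The size of an expression outside its abstractions. -/
def size : {s : Kind} → Expr s → ℕ
  | _, var _ => 0
  | _, lam _ => 0
  | _, app M N => 1 + size M + size N + weight M + weight N
  | _, mu _ => 1
  | _, jmp _ M => size M
  | _, lets L M => 1 + size L + size M

theorem size_rename {s : Kind} (P : Expr s) (r q : ℕ → ℕ) : size (P.rename r q) = size P := by
  induction P generalizing r q <;> simp_all [size, Expr.rename, weight_rename]

theorem size_of_isValue {V : Term} (hV : V.IsValue) : size V = 0 := by
  cases V <;> first | rfl | exact hV.elim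

/-- Values have size and weight 0, as variables do, so substituting them costs nothing. -/
theorem size_subst {s : Kind} (P : Expr s) {σ : ℕ → Term} (hσ : ∀ x, (σ x).IsValue) :
    size (P.subst σ) = size P := by
  induction P generalizing σ with
  | var x => exact size_of_isValue (hσ x)
  | lam M ih => rfl
  | app M N ihM ihN => simp only [Expr.subst, size, ihM hσ, ihN hσ, weight_subst _ hσ]
  | mu J ih => rfl
  | jmp k M ih => exact ih hσ
  | lets L M ihL ihM => simp only [Expr.subst, size, ihM hσ, ihL (isValue_upSubst hσ)]

/-- The redex has to be a non-value: its weight is then maximal, so the contractum cannot increase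
the weight seen by an enclosing application. -/
theorem size_plug_lt (E : ECtx) {P Q : Term} (hP : ¬ P.IsValue) (h : size Q < size P) :
    size (E.plug Q) < size (E.plug P) := by
  have hw : weight Q ≤ weight P := (weight_le Q).trans_eq (weight_of_not_isValue hP).symm
  induction E generalizing P Q with
  | hole => exact h
  | appR E V hV ih => exact ih id (by simp only [size]; omega) le_rfl
  | appL E M ih => exact ih id (by simp only [size]; omega) le_rfl
  | letArg E M ih => exact ih id (by simp only [size]; omega) le_rfl

/-- An evaluation step either decreases the size and keeps the answers, or else advances the
answers. -/
theorem E₀Step.sem_eq {L M : Term} (h : E₀Step L M) (τ : ℕ) (ρ : ℕ → Dom true)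
    (δ : ℕ → Dom false) (c : Dom false) :
    (sem τ L ρ δ c = sem τ M ρ δ c ∧ size M < size L) ∨
      sem τ L ρ δ c = tick τ (sem τ M ρ δ c) := by
  cases h with
  | mu_app E J M =>
    obtain ⟨d, hd⟩ := exists_plug_cont τ E ρ δ c
    refine .inl ⟨by rw [hd, hd, sem_let_left], size_plug_lt E id ?_⟩
    have h₀ : weight (var 0) = 0 := rfl
    have h₁ : weight (mu J) = 2 := rfl
    simp only [size, wk, size_rename, weight_rename]
    omega
  | app_mu E V J hV =>
    obtain ⟨d, hd⟩ := exists_plug_cont τ E ρ δ c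
    refine .inl ⟨by rw [hd, hd, sem_let_right τ hV], size_plug_lt E id ?_⟩
    have h₀ : weight (var 0) = 0 := rfl
    have h₁ : weight (mu J) = 2 := rfl
    simp only [size, wk, size_rename, weight_rename]
    omega
  | beta_lam E M V hV =>
    obtain ⟨d, hd⟩ := exists_plug_cont τ E ρ δ c
    exact .inr (by rw [hd, hd, sem_app_lam τ M hV])
  | beta_let E M V hV =>
    obtain ⟨d, hd⟩ := exists_plug_cont τ E ρ δ c
    refine .inl ⟨by rw [hd, hd, sem_lets_subst τ M hV], size_plug_lt E id ?_⟩
    simp only [subst1, size, size_subst M (isValue_single hV)]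
    omega
  | beta_mu E M J =>
    obtain ⟨d, hd⟩ := exists_plug_cont τ E ρ δ c
    refine .inl ⟨by rw [hd, hd, sem_lets_mu], size_plug_lt E id ?_⟩
    simp only [size]
    omega

theorem plug_ne_mu (E : ECtx) {P : Term} (h : ∀ J, P ≠ mu J) (J : Jump) : E.plug P ≠ mu J := by
  induction E generalizing P with
  | hole => exact h J
  | appR E V hV ih => exact ih fun _ => by simp
  | appL E M ih => exact ih fun _ => by simp
  | letArg E M ih => exact ih fun _ => by simp

theorem not_e₀Step_mu {J : Jump} {M : Term} (h : E₀Step (mu J) M) : False := by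
  generalize hL : mu J = L at h
  cases h <;> exact plug_ne_mu _ (fun _ => by simp) J hL.symm

theorem Reads.sem_eq {J : Jump} {l : ℕ} {L : Term} (h : Reads J l L) (τ : ℕ) (ρ : ℕ → Dom true)
    (δ : ℕ → Dom false) (c : Dom false) : sem τ J ρ δ c = sem τ L ρ δ (δ l) := by
  induction h generalizing ρ δ c with
  | jmp l L => rfl
  | lets M h ih => simp only [sem, ih]

theorem Reads.size_eq {J : Jump} {l : ℕ} {L : Term} (h : Reads J l L) : size J = size L := by
  induction h with
  | jmp l L => rfl
  | lets M h ih => simp only [size, ih]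

/-! ### Answers at cost one force termination -/

/-- The evaluation of the term terminates. -/
def Terminates (M : Term) : Prop := ∃ N, EvaluatesTo M N

theorem Terminates.of_eStep {M N : Term} (h : EStep M N) (hN : Terminates N) : Terminates M := by
  obtain ⟨P, hP, hP'⟩ := hN
  exact ⟨P, .head h hP, hP'⟩

theorem terminates_of_forall_eStep {M : Term} (h : ∀ N, EStep M N → Terminates N) :
    Terminates M := by
  by_cases hM : ENormal M
  · exact ⟨M, .refl, hM⟩
  · simp only [ENormal, not_forall, not_not] at hM
    obtain ⟨N, hN⟩ := hM
    exact (h N hN).of_eStep hN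

/-- Lexicographic induction on the answer `n` and the size of the body. The body is measured because
`size` does not look under `μ`, while evaluation does. -/
theorem terminates_mu (n m : ℕ) (J : Jump) (hm : size J = m) (h : answers 1 (mu J) n) :
    Terminates (mu J) := by
  induction n using Nat.strong_induction_on generalizing m J with
  | _ n ihn =>
  induction m using Nat.strong_induction_on generalizing J with
  | _ m ihm =>
  refine terminates_of_forall_eStep fun N hN => ?_
  obtain ⟨hn, h'⟩ := h
  cases hN with
  | @collapse J₀ l J hJ =>
    rw [hJ.sem_eq] at h'
    obtain ⟨hn', h'⟩ := h'
    -- Two nested `μ`s cost 2 and the collapsed one costs 1, so `n - 1` is an answer of the result.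
    -- The size may grow.
    refine ihn (n - 1) (by omega) _ _ rfl ⟨by omega, ?_⟩
    rwa [sem_substCont]
  | base h => exact (not_e₀Step_mu h).elim
  | @under J₀ l L M hJ hs =>
    rw [hJ.sem_eq] at h'
    rcases hs.sem_eq 1 (fun _ => full true) (cons (full false) fun _ => full false)
      (cons (full false) (fun _ => full false) l) with ⟨he, hlt⟩ | he
    · rw [he] at h'
      exact ihm (size M) (by rw [← hm, hJ.size_eq]; exact hlt) (jmp l M) rfl ⟨hn, h'⟩
    · rw [he] at h'
      exact ihn (n - 1) (by omega) _ (jmp l M) rfl ⟨by have := h'.1; omega, h'.2⟩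

theorem terminates_of_answers (n m : ℕ) (M : Term) (hm : size M = m) (h : answers 1 M n) :
    Terminates M := by
  induction n using Nat.strong_induction_on generalizing m M with
  | _ n ihn =>
  induction m using Nat.strong_induction_on generalizing M with
  | _ m ihm =>
  by_cases hM : ∃ J, M = mu J
  · obtain ⟨J, rfl⟩ := hM
    exact terminates_mu n _ J rfl h
  refine terminates_of_forall_eStep fun N hN => ?_
  cases hN with
  | collapse => exact (hM ⟨_, rfl⟩).elim
  | under => exact (hM ⟨_, rfl⟩).elim
  | base hs =>
    rcases hs.sem_eq 1 (fun _ => full true) (fun _ => full false) (full false) with ⟨he, hlt⟩ | he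
    · rw [answers, he] at h
      exact ihm _ (hm ▸ hlt) _ rfl h
    · rw [answers, he] at h
      exact ihn _ (by have := h.1; omega) _ _ rfl h.2

/-! ### Progress and the answers of normal forms -/

/-- Composition of evaluation contexts. -/
def ECtx.comp (F : ECtx) : ECtx → ECtx
  | hole => F
  | appR E V hV => appR (ECtx.comp F E) V hV
  | appL E M => appL (ECtx.comp F E) M
  | letArg E M => letArg (ECtx.comp F E) M

theorem plug_comp (F E : ECtx) (P : Term) : (F.comp E).plug P = F.plug (E.plug P) := by
  induction E generalizing P with
  | hole => rfl
  | appR E V hV ih => exact ih _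
  | appL E M ih => exact ih _
  | letArg E M ih => exact ih _

theorem E₀Step.plug (F : ECtx) {L M : Term} (h : E₀Step L M) : E₀Step (F.plug L) (F.plug M) := by
  cases h <;> simp only [← plug_comp] <;> constructor <;> assumption

/-- A term is a value, a `μ`-abstraction, reducible, or yields every answer. -/
theorem progress : (M : Term) → M.IsValue ∨ (∃ J, M = mu J) ∨ (∃ N, E₀Step M N) ∨
    ∀ (δ : ℕ → Dom false) (c : Dom false) (n : ℕ), sem 0 M (fun _ => full true) δ c n
  | var _ => .inl trivial
  | lam _ => .inl trivial
  | mu J => .inr (.inl ⟨J, rfl⟩)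
  | lets L M => by
    rcases progress M with h | ⟨J, rfl⟩ | ⟨N, h⟩ | h
    · exact .inr (.inr (.inl ⟨_, .beta_let .hole L M h⟩))
    · exact .inr (.inr (.inl ⟨_, .beta_mu .hole L J⟩))
    · exact .inr (.inr (.inl ⟨_, h.plug (.letArg .hole L)⟩))
    · exact .inr (.inr (.inr fun δ c n => h δ _ n))
  | app M N => by
    rcases progress M with hM | ⟨J, rfl⟩ | ⟨M', h⟩ | h
    · rcases progress N with hN | ⟨J, rfl⟩ | ⟨N', h⟩ | h
      · cases M with
        | var x =>
          refine .inr (.inr (.inr fun δ c n => ?_))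
          simp only [sem_app_values 0 (V := var x) trivial hN, tick_zero]
          -- A free variable denotes the greatest filter, which contains the types without
          -- requirements for every answer `n`.
          exact ⟨0, 0, Fin.elim0, Fin.elim0, trivial, fun i => i.elim0, fun i => i.elim0⟩
        | lam M => exact .inr (.inr (.inl ⟨_, .beta_lam .hole M N hN⟩))
        | _ => exact hM.elim
      · exact .inr (.inr (.inl ⟨_, .app_mu .hole M J hM⟩))
      · exact .inr (.inr (.inl ⟨_, h.plug (.appR .hole M hM)⟩))
      · refine .inr (.inr (.inr fun δ c n => ?_))
        simp only [sem_app_left_value 0 hM]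
        exact h δ _ n
    · exact .inr (.inr (.inl ⟨_, .mu_app .hole J N⟩))
    · exact .inr (.inr (.inl ⟨_, h.plug (.appL .hole N)⟩))
    · exact .inr (.inr (.inr fun δ c n => h δ _ n))

theorem exists_reads : (J : Jump) → ∃ l L, Reads J l L
  | jmp k M => ⟨k, M, .jmp k M⟩
  | lets J M => by
    obtain ⟨l, N, h⟩ := exists_reads J
    exact ⟨l, _, h.lets M⟩

theorem accept_full (A : Dom true) (n : ℕ) : accept (full false) A n :=
  ⟨0, Fin.elim0, trivial, fun i => i.elim0⟩

/-- Progress is applied to the term and, below a leading `μ`, to the term read off its jump. Every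
alternative that allows a step is excluded; in the others a greatest continuation or a head variable
gives the answer. -/
theorem answers_of_eNormal {N : Term} (h : ENormal N) (n : ℕ) : answers 0 N n := by
  rcases progress N with hN | ⟨J, rfl⟩ | ⟨P, hP⟩ | hN
  · rw [answers, sem_of_isValue 0 hN]
    exact accept_full _ n
  · obtain ⟨l, L, hL⟩ := exists_reads J
    rw [answers, sem, tick_zero, hL.sem_eq, cons_const]
    rcases progress L with hV | ⟨J', rfl⟩ | ⟨P, hP⟩ | hL'
    · rw [sem_of_isValue 0 hV]
      exact accept_full _ n
    · exact (h _ (.collapse hL)).elim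
    · exact (h _ (.under hL hP)).elim
    · exact hL' _ _ n
  · exact (h _ (.base hP)).elim
  · exact hN _ _ n

/-! ### Evaluation is contained in the equality -/

theorem CcvEq.plug (E : ECtx) {P Q : Term} (h : CcvEq P Q) : CcvEq (E.plug P) (E.plug Q) := by
  induction E generalizing P Q with
  | hole => exact h
  | appR E V hV ih => exact ih (.app (.refl V) h)
  | appL E M ih => exact ih (.app h (.refl M))
  | letArg E M ih => exact ih (.lets (.refl M) h)

theorem E₀Step.ccvEq {L M : Term} (h : E₀Step L M) : CcvEq L M := by
  cases h with
  | mu_app E J M => exact .plug E (.red (.ad₁ _ _ id))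
  | app_mu E V J hV => exact .plug E (.red (.ad₂ _ _ hV id))
  | beta_lam E M V hV => exact .plug E (.red (.beta_lam _ _ hV))
  | beta_let E M V hV => exact .plug E (.red (.beta_let _ _ hV))
  | beta_mu E M J => exact .plug E (.red (.beta_mu _ _))

theorem Reads.ccvEq {J : Jump} {l : ℕ} {L : Term} (h : Reads J l L) : CcvEq J (Expr.jmp l L) := by
  induction h with
  | jmp l L => exact .refl _
  | lets M h ih => exact (CcvEq.lets ih (.refl M)).trans (.symm (.bracket (.jmp_lets _ _ _)))

theorem EStep.ccvEq {M N : Term} (h : EStep M N) : CcvEq M N := by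
  cases h with
  | collapse hJ => exact .mu (hJ.ccvEq.trans (.red (.beta_jmp _ _)))
  | base h => exact h.ccvEq
  | under hJ h => exact .mu (hJ.ccvEq.trans (.jmp _ h.ccvEq))

theorem EvaluatesTo.ccvEq {M N : Term} (h : EvaluatesTo M N) : CcvEq M N := by
  obtain ⟨h, -⟩ := h
  induction h with
  | refl => exact .refl _
  | tail _ h ih => exact ih.trans h.ccvEq

end CCV

theorem mainTheorem9 (M N M' : CCV.Term) (hN : CCV.EvaluatesTo M N) (hM : CCV.CcvEq M M') :
    (∃ N' : CCV.Term, CCV.EvaluatesTo M' N') ∧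
      ∀ N' : CCV.Term, CCV.EvaluatesTo M' N' → CCV.CcvEq N N' := by
  have hNM : CCV.CcvEq N M' := hN.ccvEq.symm.trans hM
  refine ⟨?_, fun N' hN' => hNM.trans hN'.ccvEq⟩
  -- Any answer would do, since `N` has them all.
  have h := CCV.answers_of_eNormal hN.2 0
  rw [CCV.answers, CCV.sem_eq_of_ccvEq hNM] at h
  obtain ⟨n, hn⟩ := CCV.exists_answer 1 h
  exact CCV.terminates_of_answers n _ M' rfl hn
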